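/- Let $(V_i)_{i\ge 0}$, $(A_i)_{i\ge 0}$, $(B_i)_{i\ge 0}$ be mutually independent sequences of i.i.d. real random variables, with $A_i\ge 0$ and $B_i\ge 0$ a.s., and let $V,A,B$ denote generic elements of the sequences. For $w\ge 0$ define $W_0=w$ and $W_{i+1}=\max\{V_iW_i+B_i-A_i,\,0\}$, $i\ge 0$. For a non-negative random variable $X$ write $\tilde X(s)=\mathbb E\,e^{-sX}$, $\operatorname{Re}s\ge 0$. Assume (A) $V<0$ a.s.; (B) $B$ has a rational Laplace–Stieltjes transform $\tilde B(s)=N_B(s)/D_B(s)$ for $\operatorname{Re}s\ge 0$, where $D_B(s)=\prod_{i=1}^{\ell}(s-s_i)$ with $\operatorname{Re}s_i<0$ for all $i$, and $N_B$ is a polynomial of degree at most $\ell-1$ having no zero in common with $D_B$; and $\mathbb P(B\le A)>0$. Then $W_i$ converges weakly, as $i\to\infty$, to a proper (i.e. finite, non-negative) random variable $W$ whose law does not depend on $w$, and there are constants $a_0,\dots,a_\ell\in\mathbb C$, not depending on $w$, such that $$\tilde W(s)=\frac{\sum_{k=0}^{\ell}a_ks^k}{D_B(s)},\qquad \operatorname{Re}s\ge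 0,$$ where $a_0=(-1)^\ell\prod_{i=1}^{\ell}s_i$, and $a_0,\dots,a_\ell$ satisfy the homogeneous linear system $$\sum_{k=0}^{\ell}a_ks_j^k\left(1-N_B(s_j)\,\tilde A(-s_j)\int_{(-\infty,0)}\frac{y^k}{\prod_{m=1}^{\ell}(s_jy-s_m)}\,\mathbb P(V\in dy)\right)=0,\qquad j=1,\dots,\ell.$$ Moreover, for every $w\ge 0$ there are $a_0(r),\dots,a_\ell(r)\in\mathbb C$, $r\in(0,1)$, with $$\sum_{i=0}^{\infty}r^i\,\tilde W_i(s)=e^{-sw}+\frac{\sum_{k=0}^{\ell}a_k(r)s^k}{D_B(s)},\qquad r\in(0,1),\ \operatorname{Re}s\ge 0,$$ and $a_k=\lim_{r\uparrow 1}(1-r)\,a_k(r)$ for $k=0,\dots,\ell$. -/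

import Mathlib

open MeasureTheory ProbabilityTheory Filter Topology

noncomputable section

/-- The recursion `W_{i+1} = [V_i W_i + Y_i]^+` started at `W_0 = w`. -/
def lindleyProcess {Ω : Type*} (w : ℝ) (V Y : ℕ → Ω → ℝ) : ℕ → Ω → ℝ
  | 0 => fun _ => w
  | i + 1 => fun ω => max (V i ω * lindleyProcess w V Y i ω + Y i ω) 0

/-- The Laplace-Stieltjes transform `E e^{-sX}` of a random variable `X` (used where the
integrand is bounded: `X ≥ 0` a.s. and `Re s ≥ 0`). -/
def lst {Ω : Type*} [MeasurableSpace Ω] (P : Measure Ω) (X : Ω → ℝ) (s : ℂ) : ℂ :=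
  ∫ ω, Complex.exp (-s * (X ω : ℂ)) ∂P

/-- The generating function `∑_{i ≥ 0} r^i E e^{-s X_i}` of the transforms of a sequence. -/
def lstGen {Ω : Type*} [MeasurableSpace Ω] (P : Measure Ω) (X : ℕ → Ω → ℝ) (r : ℝ) (s : ℂ) : ℂ :=
  ∑' i : ℕ, (r : ℂ) ^ i * lst P (X i) s

/-- The monic polynomial function `∏_i (s - s_i)`. -/
def poleProd {n : ℕ} (p : Fin n → ℂ) (s : ℂ) : ℂ := ∏ i, (s - p i)

/-- `X` has a rational transform `N(s) / ∏_i (s - s_i)` with poles `s_1, …, s_n` (listed with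
multiplicity) and a numerator `N` of degree at most `n - 1` that shares no zero with the
denominator. -/
structure HasRationalLST {Ω : Type*} [MeasurableSpace Ω] (P : Measure Ω) (X : Ω → ℝ) {n : ℕ}
    (p : Fin n → ℂ) (N : Polynomial ℂ) : Prop where
  degree_lt : N.degree < (n : WithBot ℕ)
  eval_ne_zero : ∀ i, N.eval (p i) ≠ 0
  lst_eq : ∀ s : ℂ, 0 ≤ s.re → lst P X s = N.eval s / poleProd p s

end

/-! With W ≥ 0 the current state, Z = A - V W is a.s. nonnegative because V < 0, it is independent
of B, and the next state is max (B - Z) 0. For fixed z ≥ 0, splitting on B ≤ z shows that D_B(s) E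
e^{-s max(B - z, 0)} equals N_B(s) e^{sz} + D_B(s) (P(B ≤ z) - E[e^{s(z - B)}; B ≤ z]) for Re s ≥ 0.
The right side is entire. It is O((1 + |s|)^ℓ) in the right half plane by the first expression and
in the left half plane by the second, so by Liouville it is a polynomial of degree at most ℓ, with
value N_B(s_j) e^{s_j z} at a pole s_j (`exists_polynomial_lst_max_sub`).

Averaging over Z preserves this form, and E e^{s_j Z} factors as E e^{s_j A} times the integral of
the transform of W at s_j y over the law of V, where s_j y lies in the right half plane
(`exists_polynomial_lst_step`). For a stationary W the same polynomial occurs on both sides, which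
is the linear system; a_0 comes from s = 0.

A stationary law exists because V ≤ 0 and B ≤ A force the next state to be 0 whatever the current
one. Decomposing at the last such reset gives convergence from every start
(`exists_invariant_of_reset`). Each transient transform is also a polynomial over D_B. Its
coefficients are fixed linear combinations of its values at 0, …, ℓ, hence converge, and Abel's
theorem gives the limit of (1 - r) a_k(r). -/

/-! ### Liouville's theorem with polynomial growth -/

/-- A polynomial of degree at most `n` grows at most like `(1 + ‖z‖) ^ n`. -/
theorem Polynomial.exists_norm_eval_le (Q : Polynomial ℂ) {n : ℕ} (hQ : Q.natDegree ≤ n) :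
    ∃ C : ℝ, 0 ≤ C ∧ ∀ z : ℂ, ‖Q.eval z‖ ≤ C * (1 + ‖z‖) ^ n := by
  refine ⟨∑ i ∈ Finset.range (n + 1), ‖Q.coeff i‖, by positivity, fun z => ?_⟩
  rw [Polynomial.eval_eq_sum_range' (Nat.lt_succ_of_le hQ), Finset.sum_mul]
  refine (norm_sum_le _ _).trans (Finset.sum_le_sum fun i hi => ?_)
  rw [norm_mul, norm_pow]
  gcongr
  calc ‖z‖ ^ i ≤ (1 + ‖z‖) ^ i := by gcongr; linarith
    _ ≤ (1 + ‖z‖) ^ n :=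
      pow_le_pow_right₀ (by linarith [norm_nonneg z]) (Nat.lt_succ_iff.1 (Finset.mem_range.1 hi))

/-- An entire function of polynomial growth of order `n` is a polynomial of degree at most `n`. -/
theorem Differentiable.exists_polynomial_of_norm_le {f : ℂ → ℂ} (hf : Differentiable ℂ f) {C : ℝ}
    {n : ℕ} (h : ∀ z, ‖f z‖ ≤ C * (1 + ‖z‖) ^ n) :
    ∃ Q : Polynomial ℂ, Q.degree < ((n + 1 : ℕ) : WithBot ℕ) ∧ ∀ z, Q.eval z = f z := by
  have hz : ∀ m, n < m → iteratedDeriv m f 0 = 0 := by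
    intro m hm
    -- Cauchy's estimate on the circle of radius R, arranged so that the last factor has a positive
    -- exponent and sends the bound to 0 as R grows.
    have hb : ∀ R : ℝ, 0 < R →
        ‖iteratedDeriv m f 0‖ ≤ (m.factorial * C) * ((1 + R) / R) ^ n * (1 / R) ^ (m - n) := by
      intro R hR
      refine (Complex.norm_iteratedDeriv_le_of_forall_mem_sphere_norm_le (C := C * (1 + R) ^ n) m hR
        hf.diffContOnCl (fun z hz => ?_)).trans_eq ?_
      · have : ‖z‖ = R := by simpa using hz
        simpa [this] using h z
      · obtain ⟨k, rfl⟩ := Nat.exists_eq_add_of_lt hm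
        rw [show n + k + 1 - n = k + 1 by omega, div_pow, div_pow, one_pow, add_assoc, pow_add]
        field_simp
    have hlim : Tendsto (fun R : ℝ => (m.factorial * C) * ((1 + R) / R) ^ n * (1 / R) ^ (m - n))
        atTop (𝓝 ((m.factorial * C) * (0 + 1) ^ n * 0 ^ (m - n))) := by
      have h1 : Tendsto (fun R : ℝ => 1 / R) atTop (𝓝 0) := by
        simpa using tendsto_inv_atTop_zero (𝕜 := ℝ)
      refine Tendsto.mul (tendsto_const_nhds.mul (Tendsto.pow ?_ _)) (h1.pow _)
      refine (h1.add tendsto_const_nhds).congr' ?_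
      filter_upwards [eventually_gt_atTop 0] with R hR
      field_simp
    rw [zero_pow (by omega), mul_zero] at hlim
    refine norm_le_zero_iff.1 (ge_of_tendsto hlim ?_)
    filter_upwards [eventually_gt_atTop 0] with R hR using hb R hR
  refine ⟨∑ i ∈ Finset.range (n + 1),
    Polynomial.monomial i ((i.factorial : ℂ)⁻¹ * iteratedDeriv i f 0), ?_, fun z => ?_⟩
  · refine (Polynomial.degree_sum_le _ _).trans_lt ?_
    rw [Finset.sup_lt_iff (WithBot.bot_lt_coe _)]
    intro i hi
    exact (Polynomial.degree_monomial_le _ _).trans_lt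
      (WithBot.coe_lt_coe.2 (Finset.mem_range.1 hi))
  · rw [← Complex.taylorSeries_eq_of_entire' 0 z hf, Polynomial.eval_finsetSum,
      tsum_eq_sum (s := Finset.range (n + 1))]
    · simp [Polynomial.eval_monomial]
    · intro m hm
      rw [hz m (by simpa using hm)]
      simp

/-! ### The denominator and bounds on transforms -/

theorem poleProd_eq_eval_nodal {l : ℕ} (p : Fin l → ℂ) (s : ℂ) :
    poleProd p s = (Lagrange.nodal Finset.univ p).eval s := by
  rw [Lagrange.eval_nodal, poleProd]

theorem poleProd_ne_zero {l : ℕ} {p : Fin l → ℂ} (hp : ∀ j, (p j).re < 0) {s : ℂ}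
    (hs : 0 ≤ s.re) : poleProd p s ≠ 0 := by
  refine Finset.prod_ne_zero_iff.2 fun i _ h => ?_
  have := hp i
  rw [← sub_eq_zero.1 h] at this
  linarith

theorem poleProd_apply_self {l : ℕ} (p : Fin l → ℂ) (j : Fin l) : poleProd p (p j) = 0 :=
  Finset.prod_eq_zero (Finset.mem_univ j) (sub_self _)

theorem norm_exp_neg_mul_ofReal_le_one {s : ℂ} (hs : 0 ≤ s.re) {x : ℝ} (hx : 0 ≤ x) :
    ‖Complex.exp (-s * (x : ℂ))‖ ≤ 1 := by
  rw [Complex.norm_exp, Real.exp_le_one_iff]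
  simp only [Complex.mul_re, Complex.neg_re, Complex.ofReal_re, Complex.ofReal_im, mul_zero,
    sub_zero]
  nlinarith

theorem integrable_exp_neg_mul {Ω : Type*} [MeasurableSpace Ω] {P : Measure Ω} [IsFiniteMeasure P]
    {X : Ω → ℝ} (hX : Measurable X) (h0 : ∀ᵐ ω ∂P, 0 ≤ X ω) {s : ℂ} (hs : 0 ≤ s.re) :
    Integrable (fun ω => Complex.exp (-s * (X ω : ℂ))) P :=
  Integrable.of_bound (by fun_prop) 1 (h0.mono fun _ h => norm_exp_neg_mul_ofReal_le_one hs h)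

theorem norm_lst_le_one {Ω : Type*} [MeasurableSpace Ω] {P : Measure Ω} [IsProbabilityMeasure P]
    {X : Ω → ℝ} (h0 : ∀ᵐ ω ∂P, 0 ≤ X ω) {s : ℂ} (hs : 0 ≤ s.re) : ‖lst P X s‖ ≤ 1 := by
  simpa [lst] using norm_integral_le_of_norm_le_const
    (h0.mono fun _ h => norm_exp_neg_mul_ofReal_le_one hs h)

/-! ### Rational transforms after subtracting and truncating -/

/-- If `X ≥ 0` has a rational transform with denominator `poleProd p`, then, multiplied by
`poleProd p`, the transform of `max (X - z) 0` is a polynomial, whose value at a pole is given by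
the numerator. -/
theorem exists_polynomial_lst_max_sub {Ω : Type*} [MeasurableSpace Ω] {P : Measure Ω}
    [IsProbabilityMeasure P] {X : Ω → ℝ} (hX : Measurable X) (h0 : ∀ᵐ ω ∂P, 0 ≤ X ω)
    {l : ℕ} {p : Fin l → ℂ} {N : Polynomial ℂ} (hp : ∀ j, (p j).re < 0)
    (hrat : HasRationalLST P X p N) {z : ℝ} (hz : 0 ≤ z) :
    ∃ Q : Polynomial ℂ, Q.degree < ((l + 1 : ℕ) : WithBot ℕ) ∧
      (∀ s : ℂ, 0 ≤ s.re → Q.eval s = poleProd p s * lst P (fun ω => max (X ω - z) 0) s) ∧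
      ∀ j, Q.eval (p j) = N.eval (p j) * Complex.exp (p j * z) := by
  -- On this event z - X is bounded, so its restricted moment generating function is entire.
  set S : Set Ω := {ω | X ω ≤ z} with hS
  have hSm : MeasurableSet S := measurableSet_le hX measurable_const
  set ν := P.restrict S
  have hνb : ∀ᵐ ω ∂ν, z - X ω ∈ Set.Icc 0 z := by
    filter_upwards [ae_restrict_of_ae h0, ae_restrict_mem hSm] with ω h1 h2
    have : X ω ≤ z := h2
    constructor <;> linarith
  have hint : ∀ s : ℂ, Integrable (fun ω => Complex.exp (s * ((z - X ω : ℝ) : ℂ))) ν := by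
    intro s
    refine Integrable.of_bound (by fun_prop) (Real.exp (|s.re| * z)) (hνb.mono fun ω h => ?_)
    rw [Complex.norm_exp, Real.exp_le_exp]
    simp only [Complex.mul_re, Complex.ofReal_re, Complex.ofReal_im, mul_zero, sub_zero]
    exact mul_le_mul (le_abs_self _) h.2 h.1 (abs_nonneg _)
  have hdiff : Differentiable ℂ (complexMGF (fun ω => z - X ω) ν) := by
    have huniv : integrableExpSet (fun ω => z - X ω) ν = Set.univ :=
      Set.eq_univ_of_forall fun t => integrable_exp_mul_of_mem_Icc (by fun_prop) hνb
    intro s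
    exact (hasDerivAt_complexMGF (by rw [huniv]; simp)).differentiableAt
  set D := Lagrange.nodal Finset.univ p with hD
  have hDdeg : D.natDegree ≤ l := by rw [hD, Lagrange.natDegree_nodal]; simp
  have hNdeg : N.natDegree ≤ l := by
    refine Polynomial.natDegree_le_iff_degree_le.2 hrat.degree_lt.le
  obtain ⟨CD, hCD, hDb⟩ := D.exists_norm_eval_le hDdeg
  obtain ⟨CN, hCN, hNb⟩ := N.exists_norm_eval_le hNdeg
  -- The continuation of D times the transform, from exp(-s max(X - z, 0)) = e^{sz} e^{-sX} + 1_{X ≤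
  -- z} (1 - e^{s(z - X)}) after replacing D times the transform of X by N.
  set f : ℂ → ℂ := fun s => N.eval s * Complex.exp (s * z) +
    D.eval s * (ν.real Set.univ - complexMGF (fun ω => z - X ω) ν s) with hf
  have hfd : Differentiable ℂ f := by
    have h1 := N.differentiable
    have h2 := D.differentiable
    fun_prop
  have hright : ∀ s : ℂ, 0 ≤ s.re → f s = poleProd p s * lst P (fun ω => max (X ω - z) 0) s := by
    intro s hs
    have hN : N.eval s = poleProd p s * lst P X s := by
      rw [hrat.lst_eq s hs, mul_div_cancel₀ _ (poleProd_ne_zero hp hs)]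
    have hsplit : lst P (fun ω => max (X ω - z) 0) s = Complex.exp (s * z) * lst P X s +
        (ν.real Set.univ - complexMGF (fun ω => z - X ω) ν s) := by
      have h1 : (ν.real Set.univ - complexMGF (fun ω => z - X ω) ν s) =
          ∫ ω, S.indicator (fun ω => 1 - Complex.exp (s * ((z - X ω : ℝ) : ℂ))) ω ∂P := by
        rw [integral_indicator hSm, integral_sub (integrable_const _) (hint s)]
        simp [complexMGF, ν]
      rw [h1, lst, lst, ← integral_const_mul, ← integral_add]
      · refine integral_congr_ae (ae_of_all _ fun ω => ?_)
        simp only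
        rw [← Complex.exp_add]
        by_cases hω : X ω ≤ z
        · rw [Set.indicator_of_mem (show ω ∈ S from hω), max_eq_right (by linarith)]
          push_cast
          rw [show s * z + -s * X ω = s * (z - X ω) by ring]
          simp
        · rw [Set.indicator_of_notMem (show ω ∉ S from hω), max_eq_left (by linarith)]
          push_cast
          rw [show s * z + -s * X ω = -s * (X ω - z) by ring, add_zero]
      · exact (integrable_exp_neg_mul hX h0 hs).const_mul _
      · exact (IntegrableOn.integrable_indicator ((integrable_const _).sub (hint s)) hSm)
    rw [hsplit, hf]
    simp only
    rw [hN, hD, ← poleProd_eq_eval_nodal]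
    ring
  -- For Re s ≥ 0 the transform is at most 1 in modulus; for Re s ≤ 0 both e^{sz} and e^{s(z - X)}
  -- on S are.
  have hbound : ∀ s, ‖f s‖ ≤ (CN + 2 * CD) * (1 + ‖s‖) ^ l := by
    intro s
    have hpos : 0 ≤ (1 + ‖s‖) ^ l := by positivity
    rcases le_total 0 s.re with hs | hs
    · have h1 : ‖lst P (fun ω => max (X ω - z) 0) s‖ ≤ 1 :=
        norm_lst_le_one (ae_of_all _ fun ω => le_max_right _ _) hs
      rw [hright s hs, norm_mul, poleProd_eq_eval_nodal]
      calc ‖D.eval s‖ * ‖lst P (fun ω => max (X ω - z) 0) s‖ ≤ CD * (1 + ‖s‖) ^ l * 1 :=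
            mul_le_mul (hDb s) h1 (norm_nonneg _) (by positivity)
        _ ≤ _ := by nlinarith [mul_nonneg hCN hpos, mul_nonneg hCD hpos]
    · have hs' : 0 ≤ (-s).re := by simpa using hs
      have h1 : ‖Complex.exp (s * z)‖ ≤ 1 := by
        simpa using norm_exp_neg_mul_ofReal_le_one hs' hz
      have hν1 : ν.real Set.univ ≤ 1 := by simp [ν, measureReal_le_one]
      have h2 : ‖complexMGF (fun ω => z - X ω) ν s‖ ≤ 1 := by
        refine (norm_integral_le_of_norm_le_const (C := 1) (hνb.mono fun ω h => ?_)).trans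
          (by simpa using hν1)
        simpa using norm_exp_neg_mul_ofReal_le_one hs' h.1
      have h3 : ‖((ν.real Set.univ : ℝ) : ℂ)‖ ≤ 1 := by
        rw [Complex.norm_real, Real.norm_of_nonneg measureReal_nonneg]; exact hν1
      calc ‖f s‖ ≤ ‖N.eval s‖ * ‖Complex.exp (s * z)‖ + ‖D.eval s‖ *
            ‖((ν.real Set.univ : ℝ) : ℂ) - complexMGF (fun ω => z - X ω) ν s‖ := by
            rw [← norm_mul, ← norm_mul]; exact norm_add_le _ _
        _ ≤ CN * (1 + ‖s‖) ^ l * 1 + CD * (1 + ‖s‖) ^ l * 2 := by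
            refine add_le_add (mul_le_mul (hNb s) h1 (norm_nonneg _) (by positivity))
              (mul_le_mul (hDb s) ?_ (norm_nonneg _) (by positivity))
            exact (norm_sub_le _ _).trans (by linarith)
        _ = _ := by ring
  obtain ⟨Q, hQd, hQ⟩ := hfd.exists_polynomial_of_norm_le hbound
  refine ⟨Q, hQd, fun s hs => (hQ s).trans (hright s hs), fun j => ?_⟩
  rw [hQ, hf]
  simp only
  rw [hD, ← poleProd_eq_eval_nodal, poleProd_apply_self, zero_mul, add_zero]

/-! ### Interpolation and mixing over the subtracted variable -/

/-- The equally spaced nodes `0, 1, …, l` used for interpolation in the right half plane. -/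
theorem injOn_natCast_range (l : ℕ) :
    Set.InjOn (fun i : ℕ => (i : ℂ)) (Finset.range (l + 1) : Set ℕ) :=
  fun _ _ _ _ h => Nat.cast_injective h

theorem Polynomial.eval_eq_sum_basis_of_degree_lt {l : ℕ} {Q : Polynomial ℂ}
    (hQ : Q.degree < ((l + 1 : ℕ) : WithBot ℕ)) (t : ℂ) :
    Q.eval t = ∑ i ∈ Finset.range (l + 1),
      Q.eval (i : ℂ) * (Lagrange.basis (Finset.range (l + 1)) (fun i : ℕ => (i : ℂ)) i).eval t := by
  conv_lhs => rw [Lagrange.eq_interpolate (injOn_natCast_range l) (f := Q) (by simpa using hQ)]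
  simp [Lagrange.interpolate_apply, Polynomial.eval_finsetSum]

theorem Polynomial.coeff_eq_sum_basis_of_degree_lt {l : ℕ} {Q : Polynomial ℂ}
    (hQ : Q.degree < ((l + 1 : ℕ) : WithBot ℕ)) (k : ℕ) :
    Q.coeff k = ∑ i ∈ Finset.range (l + 1),
      Q.eval (i : ℂ) *
        (Lagrange.basis (Finset.range (l + 1)) (fun i : ℕ => (i : ℂ)) i).coeff k := by
  conv_lhs => rw [Lagrange.eq_interpolate (injOn_natCast_range l) (f := Q) (by simpa using hQ)]
  simp [Lagrange.interpolate_apply, Polynomial.finsetSum_coeff]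

theorem stronglyMeasurable_lst_max_sub {Ω : Type*} [MeasurableSpace Ω] {P : Measure Ω} [SFinite P]
    {X : Ω → ℝ} (hX : Measurable X) (s : ℂ) :
    StronglyMeasurable fun z : ℝ => lst P (fun ω => max (X ω - z) 0) s := by
  refine StronglyMeasurable.integral_prod_right'
    (f := fun y : ℝ × Ω => Complex.exp (-s * ((max (X y.2 - y.1) 0 : ℝ) : ℂ))) ?_
  exact Measurable.stronglyMeasurable (by fun_prop)

/-- The transform of `max (X - Z) 0` for `Z ≥ 0` independent of `X`, with `X` as in
`exists_polynomial_lst_max_sub`. -/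
theorem exists_polynomial_integral_lst_max_sub {Ω : Type*} [MeasurableSpace Ω] {P : Measure Ω}
    [IsProbabilityMeasure P] {X : Ω → ℝ} (hX : Measurable X) (h0 : ∀ᵐ ω ∂P, 0 ≤ X ω)
    {l : ℕ} {p : Fin l → ℂ} {N : Polynomial ℂ} (hp : ∀ j, (p j).re < 0)
    (hrat : HasRationalLST P X p N) (ζ : Measure ℝ) [IsProbabilityMeasure ζ]
    (hζ : ∀ᵐ z ∂ζ, 0 ≤ z) :
    ∃ Q : Polynomial ℂ, Q.degree < ((l + 1 : ℕ) : WithBot ℕ) ∧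
      (∀ s : ℂ, 0 ≤ s.re →
        Q.eval s = poleProd p s * ∫ z, lst P (fun ω => max (X ω - z) 0) s ∂ζ) ∧
      ∀ j, Q.eval (p j) = N.eval (p j) * ∫ z : ℝ, Complex.exp (p j * z) ∂ζ := by
  have hex : ∀ z : ℝ, ∃ Q : Polynomial ℂ, 0 ≤ z → Q.degree < ((l + 1 : ℕ) : WithBot ℕ) ∧
      (∀ s : ℂ, 0 ≤ s.re → Q.eval s = poleProd p s * lst P (fun ω => max (X ω - z) 0) s) ∧
      ∀ j, Q.eval (p j) = N.eval (p j) * Complex.exp (p j * z) := by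
    intro z
    by_cases hz : 0 ≤ z
    · obtain ⟨Q, hQ⟩ := exists_polynomial_lst_max_sub hX h0 hp hrat hz
      exact ⟨Q, fun _ => hQ⟩
    · exact ⟨0, fun h => absurd h hz⟩
  choose q hq using hex
  have hint : ∀ s : ℂ, 0 ≤ s.re → Integrable (fun z => lst P (fun ω => max (X ω - z) 0) s) ζ := by
    intro s hs
    exact Integrable.of_bound (stronglyMeasurable_lst_max_sub hX s).aestronglyMeasurable 1
      (ae_of_all _ fun z => norm_lst_le_one (ae_of_all _ fun ω => le_max_right _ _) hs)
  -- Interpolating the averaged values at nodes in the right half plane avoids any measurability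
  -- question for the chosen q z: every evaluation of q z is a finite combination of bounded
  -- measurable functions of z.
  set Q : Polynomial ℂ := Lagrange.interpolate (Finset.range (l + 1)) (fun i : ℕ => (i : ℂ))
    (fun i => poleProd p i * ∫ z, lst P (fun ω => max (X ω - z) 0) i ∂ζ) with hQ
  have hQdeg : Q.degree < ((l + 1 : ℕ) : WithBot ℕ) := by
    refine (Lagrange.degree_interpolate_lt _ (injOn_natCast_range l)).trans_eq ?_
    rw [Finset.card_range]
  have hQeval : ∀ t, Q.eval t = ∫ z, (q z).eval t ∂ζ := by
    intro t
    have h1 : (fun z => (q z).eval t) =ᵐ[ζ] fun z => ∑ i ∈ Finset.range (l + 1),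
        (poleProd p i * lst P (fun ω => max (X ω - z) 0) i) *
        (Lagrange.basis (Finset.range (l + 1)) (fun i : ℕ => (i : ℂ)) i).eval t := by
      filter_upwards [hζ] with z hz
      rw [Polynomial.eval_eq_sum_basis_of_degree_lt (hq z hz).1 t]
      refine Finset.sum_congr rfl fun i _ => ?_
      rw [(hq z hz).2.1 i (by simp)]
    rw [integral_congr_ae h1, integral_finsetSum, Polynomial.eval_eq_sum_basis_of_degree_lt hQdeg t]
    · refine Finset.sum_congr rfl fun i hi => ?_
      rw [integral_mul_const, integral_const_mul, hQ,
        Lagrange.eval_interpolate_at_node (v := fun i : ℕ => (i : ℂ)) _ (injOn_natCast_range l) hi]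
    · exact fun i _ => ((hint i (by simp)).const_mul _).mul_const _
  refine ⟨Q, hQdeg, fun s hs => ?_, fun j => ?_⟩
  · rw [hQeval, ← integral_const_mul]
    exact integral_congr_ae (hζ.mono fun z hz => (hq z hz).2.1 s hs)
  · rw [hQeval, ← integral_const_mul]
    exact integral_congr_ae (hζ.mono fun z hz => (hq z hz).2.2 j)

/-! ### Random iterations with a reset state -/

section Regeneration

variable {E T : Type*} [MeasurableSpace E] [MeasurableSpace T]

theorem map_prod_restrict_eq_dirac {φ : E × T → E} {ρ : Measure T} [SFinite ρ]
    {S : Set T} (hS : MeasurableSet S) {e : E} (hφS : ∀ x, ∀ t ∈ S, φ (x, t) = e)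
    (ν : Measure E) [SFinite ν] :
    (ν.prod (ρ.restrict S)).map φ = (ν Set.univ * ρ S) • Measure.dirac e := by
  have h : φ =ᵐ[ν.prod (ρ.restrict S)] fun _ => e := by
    have h2 : ∀ᵐ t ∂ρ.restrict S, t ∈ S := ae_restrict_mem hS
    have := Measure.quasiMeasurePreserving_snd (μ := ν) (ν := ρ.restrict S) |>.ae h2
    filter_upwards [this] with y hy using hφS y.1 y.2 hy
  rw [Measure.map_congr h, Measure.map_const, ← Set.univ_prod_univ, Measure.prod_prod]
  simp

/-- A random iteration `x ↦ φ (x, t)` that resets to a fixed state `e` whenever `t ∈ S`, an event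
of positive probability, has an invariant law, and the laws of the iterates converge to it. -/
theorem exists_invariant_of_reset {φ : E × T → E} (hφ : Measurable φ) (π : Measure T)
    [IsProbabilityMeasure π] {S : Set T} (hS : MeasurableSet S) (hπS : π S ≠ 0) {e : E}
    (hφS : ∀ x, ∀ t ∈ S, φ (x, t) = e) :
    ∃ μ : Measure E, IsProbabilityMeasure μ ∧ (μ.prod π).map φ = μ ∧
      ∀ ν : ℕ → Measure E, IsProbabilityMeasure (ν 0) →
        (∀ n, ν (n + 1) = ((ν n).prod π).map φ) →
        ∀ {F : Type*} [NormedAddCommGroup F] [NormedSpace ℝ F] (f : E → F) (C : ℝ),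
          StronglyMeasurable f → (∀ x, ‖f x‖ ≤ C) →
          Tendsto (fun n => ∫ x, f x ∂ν n) atTop (𝓝 (∫ x, f x ∂μ)) := by
  set R : Measure E → Measure E := fun ν => (ν.prod (π.restrict Sᶜ)).map φ with hR
  have hRuniv : ∀ ν : Measure E, R ν Set.univ = ν Set.univ * π Sᶜ := by
    intro ν
    rw [hR]
    simp only
    rw [Measure.map_apply hφ MeasurableSet.univ, Set.preimage_univ, ← Set.univ_prod_univ,
      Measure.prod_prod, Measure.restrict_apply_univ]
  have hRit : ∀ (ν : Measure E) n, R^[n] ν Set.univ = ν Set.univ * π Sᶜ ^ n := by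
    intro ν n
    induction n with
    | zero => simp
    | succ n ih => rw [Function.iterate_succ_apply', hRuniv, ih, pow_succ, mul_assoc]
  have hRfin : ∀ (ν : Measure E) [IsFiniteMeasure ν] n, IsFiniteMeasure (R^[n] ν) := by
    intro ν _ n
    refine ⟨?_⟩
    rw [hRit]
    exact ENNReal.mul_lt_top (measure_lt_top _ _) (ENNReal.pow_lt_top (measure_lt_top _ _))
  have hRadd : ∀ ν₁ ν₂ : Measure E, SFinite ν₁ → SFinite ν₂ → R (ν₁ + ν₂) = R ν₁ + R ν₂ := by
    intro ν₁ ν₂ _ _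
    simp only [hR]
    rw [Measure.add_prod, Measure.map_add _ _ hφ]
  have hRsmul : ∀ (c : ENNReal) (ν : Measure E), R (c • ν) = c • R ν := by
    intro c ν
    simp only [hR]
    rw [Measure.prod_smul_left, Measure.map_smul]
  have hstep : ∀ ν : Measure E, IsProbabilityMeasure ν →
      (ν.prod π).map φ = R ν + π S • Measure.dirac e := by
    intro ν _
    conv_lhs => rw [← Measure.restrict_compl_add_restrict (μ := π) hS]
    rw [Measure.prod_add, Measure.map_add _ _ hφ, map_prod_restrict_eq_dirac hS hφS, measure_univ,
      one_mul]
  -- The stationary contribution of a last reset k steps ago, followed by k steps without reset. The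
  -- masses form a geometric series with sum 1.
  set m : ℕ → Measure E := fun k => π S • R^[k] (Measure.dirac e) with hm
  have hmfin : ∀ k, IsFiniteMeasure (m k) := fun k => by
    have := hRfin (Measure.dirac e) k
    exact Measure.smul_finite _ (measure_ne_top _ _)
  have hmsucc : ∀ k, R (m k) = m (k + 1) := fun k => by
    simp only [hm]
    rw [hRsmul, Function.iterate_succ_apply']
  set μ := Measure.sum m with hμ
  have hμprob : IsProbabilityMeasure μ := by
    refine ⟨?_⟩
    rw [hμ, Measure.sum_apply _ MeasurableSet.univ]
    simp only [hm, Measure.smul_apply, smul_eq_mul, hRit, measure_univ, one_mul]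
    rw [ENNReal.tsum_mul_left, ENNReal.tsum_geometric, prob_compl_eq_one_sub hS,
      ENNReal.sub_sub_cancel ENNReal.one_ne_top prob_le_one,
      ENNReal.mul_inv_cancel hπS (measure_ne_top _ _)]
  have hm0 : m 0 = π S • Measure.dirac e := by simp [hm]
  refine ⟨μ, hμprob, ?_, ?_⟩
  · rw [hstep μ hμprob]
    have hRμ : R μ = Measure.sum fun k => m (k + 1) := by
      simp only [hR, hμ]
      rw [Measure.prod_sum_left, Measure.map_sum hφ.aemeasurable]
      exact congrArg Measure.sum (funext fun k => hmsucc k)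
    rw [hRμ, ← hm0]
    ext A hA
    rw [hμ, Measure.add_apply, Measure.sum_apply _ hA, Measure.sum_apply _ hA,
      tsum_eq_zero_add' (f := fun i => m i A) ENNReal.summable, add_comm]
  · intro ν hν0 hν F _ _ f C hf hC
    have hprob : ∀ n, IsProbabilityMeasure (ν n) := by
      intro n
      induction n with
      | zero => exact hν0
      | succ n ih => rw [hν]; exact Measure.isProbabilityMeasure_map hφ.aemeasurable
    -- Either no reset has occurred in n steps, or the last one was k < n steps ago.
    have hdec : ∀ n, ν n = R^[n] (ν 0) + ∑ k ∈ Finset.range n, m k := by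
      intro n
      have hsum : ∀ n, SFinite (∑ k ∈ Finset.range n, m k) := fun n => by
        rw [← Measure.sum_coe_finset]; infer_instance
      have hRsum : ∀ n, R (∑ k ∈ Finset.range n, m k) = ∑ k ∈ Finset.range n, m (k + 1) := by
        intro n
        induction n with
        | zero => simp [hR]
        | succ n ih =>
          rw [Finset.sum_range_succ, Finset.sum_range_succ, hRadd _ _ (hsum n) inferInstance, ih,
            hmsucc]
      induction n with
      | zero => simp
      | succ n ih =>
        have := hRfin (ν 0) n
        rw [hν, hstep _ (hprob n)]
        conv_lhs => rw [ih]
        rw [hRadd _ _ inferInstance (hsum n), hRsum, Function.iterate_succ_apply', ← hm0,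
          Finset.sum_range_succ', add_assoc]
    have hfint : ∀ ρ : Measure E, IsFiniteMeasure ρ → Integrable f ρ := fun ρ _ =>
      Integrable.of_bound hf.aestronglyMeasurable C (ae_of_all _ hC)
    have hfm : Tendsto (fun n => ∑ k ∈ Finset.range n, ∫ x, f x ∂m k) atTop
        (𝓝 (∫ x, f x ∂μ)) :=
      (hasSum_integral_measure (hfint μ inferInstance)).tendsto_sum_nat
    have hlt : π.real Sᶜ < 1 := by
      rw [probReal_compl_eq_one_sub hS]
      have : 0 < π.real S := ENNReal.toReal_pos hπS (measure_ne_top _ _)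
      linarith
    have hfR : Tendsto (fun n => ∫ x, f x ∂(R^[n] (ν 0))) atTop (𝓝 0) := by
      have hlim : Tendsto (fun n => C * π.real Sᶜ ^ n) atTop (𝓝 0) := by
        simpa using (tendsto_pow_atTop_nhds_zero_of_lt_one measureReal_nonneg hlt).const_mul C
      refine squeeze_zero_norm (fun n => ?_) hlim
      have := hRfin (ν 0) n
      refine (norm_integral_le_of_norm_le_const (ae_of_all _ hC)).trans_eq ?_
      rw [measureReal_def, hRit, measure_univ, one_mul, ENNReal.toReal_pow, measureReal_def]
    have := hfR.add hfm
    rw [zero_add] at this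
    refine this.congr fun n => ?_
    have := hRfin (ν 0) n
    conv_rhs => rw [hdec n]
    rw [integral_add_measure (hfint _ inferInstance), integral_finsetSum_measure]
    · exact fun k _ => hfint _ inferInstance
    · rw [← Measure.sum_coe_finset]
      refine hfint _ ⟨?_⟩
      rw [Measure.sum_coe_finset, Measure.coe_finsetSum, Finset.sum_apply]
      exact ENNReal.sum_lt_top.2 fun k _ => measure_lt_top _ _

end Regeneration

/-! ### The recursion as a Markov chain -/

/-- One step of the recursion, as a function of the state `x` and the innovation `(v, a, b)`. The
state is truncated at `0`, so that the map is meaningful for every real `x`. -/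
def lindleyStep (y : ℝ × ℝ × ℝ × ℝ) : ℝ :=
  max (y.2.1 * max y.1 0 + (y.2.2.2 - y.2.2.1)) 0

theorem measurable_lindleyStep : Measurable lindleyStep := by
  unfold lindleyStep
  fun_prop

section Law

variable {Ω : Type*} {V A B : ℕ → Ω → ℝ}

theorem lindleyProcess_nonneg {w : ℝ} (hw : 0 ≤ w) (V Y : ℕ → Ω → ℝ) (n : ℕ) (ω : Ω) :
    0 ≤ lindleyProcess w V Y n ω := by
  cases n with
  | zero => exact hw
  | succ n => exact le_max_right _ _

/-- The σ-algebra generated by the innovations before time `n`. -/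
abbrev innovationsBefore (V A B : ℕ → Ω → ℝ) (n : ℕ) : MeasurableSpace Ω :=
  ⨆ i ∈ {i : ℕ ⊕ ℕ ⊕ ℕ | Sum.elim id (Sum.elim id id) i < n},
    MeasurableSpace.comap (Sum.elim V (Sum.elim A B) i) inferInstance

theorem measurable_lindleyProcess_innovationsBefore (w : ℝ) (n : ℕ) :
    Measurable[innovationsBefore V A B n]
      (lindleyProcess w V (fun i ω => B i ω - A i ω) n) := by
  have hle : ∀ (n : ℕ) (i : ℕ ⊕ ℕ ⊕ ℕ), Sum.elim id (Sum.elim id id) i < n →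
      Measurable[innovationsBefore V A B n] (Sum.elim V (Sum.elim A B) i) := by
    intro n i hi
    rw [measurable_iff_comap_le]
    exact le_biSup (fun i => MeasurableSpace.comap (Sum.elim V (Sum.elim A B) i) inferInstance) hi
  induction n with
  | zero => exact measurable_const
  | succ n ih =>
    have hmono : innovationsBefore V A B n ≤ innovationsBefore V A B (n + 1) :=
      biSup_mono fun i hi => Nat.lt_succ_of_lt hi
    have hV := hle (n + 1) (Sum.inl n) (Nat.lt_succ_self n)
    have hA := hle (n + 1) (Sum.inr (Sum.inl n)) (Nat.lt_succ_self n)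
    have hB := hle (n + 1) (Sum.inr (Sum.inr n)) (Nat.lt_succ_self n)
    exact ((hV.mul (ih.mono hmono le_rfl)).add (hB.sub hA)).max measurable_const

variable [MeasurableSpace Ω] {P : Measure Ω}

theorem indepFun_lindleyProcess_innovation
    (hVm : ∀ i, Measurable (V i)) (hAm : ∀ i, Measurable (A i)) (hBm : ∀ i, Measurable (B i))
    (hindep : iIndepFun (Sum.elim V (Sum.elim A B)) P) (w : ℝ) (n : ℕ) :
    IndepFun (lindleyProcess w V (fun i ω => B i ω - A i ω) n)
      (fun ω => (V n ω, A n ω, B n ω)) P := by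
  have hm : ∀ i, Measurable (Sum.elim V (Sum.elim A B) i) := by
    rintro (i | i | i)
    exacts [hVm i, hAm i, hBm i]
  set T : Set (ℕ ⊕ ℕ ⊕ ℕ) := {i | Sum.elim id (Sum.elim id id) i = n} with hT
  have hdisj : Disjoint {i : ℕ ⊕ ℕ ⊕ ℕ | Sum.elim id (Sum.elim id id) i < n} T :=
    Set.disjoint_left.2 fun i hi hi' => absurd (show _ = n from hi') (ne_of_lt hi)
  have hind := indep_iSup_of_disjoint (fun i => (hm i).comap_le) hindep.iIndep hdisj
  rw [IndepFun_iff_Indep]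
  refine indep_of_indep_of_le_left (indep_of_indep_of_le_right hind ?_)
    (measurable_iff_comap_le.1 (measurable_lindleyProcess_innovationsBefore w n))
  have hle : ∀ i ∈ T, Measurable[⨆ i ∈ T,
      MeasurableSpace.comap (Sum.elim V (Sum.elim A B) i) inferInstance]
      (Sum.elim V (Sum.elim A B) i) := fun i hi =>
    measurable_iff_comap_le.2
      (le_biSup (fun i => MeasurableSpace.comap (Sum.elim V (Sum.elim A B) i) inferInstance) hi)
  have hV := hle (Sum.inl n) rfl
  have hA := hle (Sum.inr (Sum.inl n)) rfl
  have hB := hle (Sum.inr (Sum.inr n)) rfl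
  exact measurable_iff_comap_le.1 (hV.prodMk (hA.prodMk hB))

theorem map_innovation_eq_prod [IsProbabilityMeasure P]
    (hVm : ∀ i, Measurable (V i)) (hAm : ∀ i, Measurable (A i)) (hBm : ∀ i, Measurable (B i))
    (hindep : iIndepFun (Sum.elim V (Sum.elim A B)) P)
    (hVid : ∀ i, IdentDistrib (V i) (V 0) P P) (hAid : ∀ i, IdentDistrib (A i) (A 0) P P)
    (hBid : ∀ i, IdentDistrib (B i) (B 0) P P) (n : ℕ) :
    P.map (fun ω => (V n ω, A n ω, B n ω)) =
      (P.map (V 0)).prod ((P.map (A 0)).prod (P.map (B 0))) := by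
  have hm : ∀ i, Measurable (Sum.elim V (Sum.elim A B) i) := by
    rintro (i | i | i)
    exacts [hVm i, hAm i, hBm i]
  have h1 : IndepFun (V n) (fun ω => (A n ω, B n ω)) P :=
    (hindep.indepFun_prodMk hm (Sum.inr (Sum.inl n)) (Sum.inr (Sum.inr n)) (Sum.inl n)
      (by simp) (by simp)).symm
  have h2 : IndepFun (A n) (B n) P :=
    hindep.indepFun (i := Sum.inr (Sum.inl n)) (j := Sum.inr (Sum.inr n)) (by simp)
  rw [(indepFun_iff_map_prod_eq_prod_map_map (hVm n).aemeasurable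
      ((hAm n).prodMk (hBm n)).aemeasurable).1 h1,
    (indepFun_iff_map_prod_eq_prod_map_map (hAm n).aemeasurable (hBm n).aemeasurable).1 h2,
    (hVid n).map_eq, (hAid n).map_eq, (hBid n).map_eq]

theorem measurable_lindleyProcess
    (hVm : ∀ i, Measurable (V i)) (hAm : ∀ i, Measurable (A i)) (hBm : ∀ i, Measurable (B i))
    (w : ℝ) (n : ℕ) : Measurable (lindleyProcess w V (fun i ω => B i ω - A i ω) n) := by
  induction n with
  | zero => exact measurable_const
  | succ n ih => exact (((hVm n).mul ih).add ((hBm n).sub (hAm n))).max measurable_const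

/-- The innovation at time n is independent of the past and has a fixed product law, so the laws
follow one transition operator. The truncation in `lindleyStep` is inactive because the states are
nonnegative. -/
theorem map_lindleyProcess_succ [IsProbabilityMeasure P]
    (hVm : ∀ i, Measurable (V i)) (hAm : ∀ i, Measurable (A i)) (hBm : ∀ i, Measurable (B i))
    (hindep : iIndepFun (Sum.elim V (Sum.elim A B)) P)
    (hVid : ∀ i, IdentDistrib (V i) (V 0) P P) (hAid : ∀ i, IdentDistrib (A i) (A 0) P P)
    (hBid : ∀ i, IdentDistrib (B i) (B 0) P P) {w : ℝ} (hw : 0 ≤ w) (n : ℕ) :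
    P.map (lindleyProcess w V (fun i ω => B i ω - A i ω) (n + 1)) =
      ((P.map (lindleyProcess w V (fun i ω => B i ω - A i ω) n)).prod
        ((P.map (V 0)).prod ((P.map (A 0)).prod (P.map (B 0))))).map lindleyStep := by
  have hWm := measurable_lindleyProcess hVm hAm hBm w n
  have hUm : Measurable fun ω => (V n ω, A n ω, B n ω) :=
    (hVm n).prodMk ((hAm n).prodMk (hBm n))
  rw [← map_innovation_eq_prod hVm hAm hBm hindep hVid hAid hBid n,
    ← (indepFun_iff_map_prod_eq_prod_map_map hWm.aemeasurable hUm.aemeasurable).1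
      (indepFun_lindleyProcess_innovation hVm hAm hBm hindep w n),
    Measure.map_map measurable_lindleyStep (hWm.prodMk hUm)]
  congr 1
  funext ω
  simp only [lindleyProcess, Function.comp_apply, lindleyStep,
    max_eq_left (lindleyProcess_nonneg hw V (fun i ω => B i ω - A i ω) n ω)]

end Law

/-! ### Transforms after one step -/

section StepTransform

variable {ν πV πA πB : Measure ℝ}

theorem ae_nonneg_sub_mul_max (hV : ∀ᵐ v ∂πV, v < 0) (hA : ∀ᵐ a ∂πA, 0 ≤ a) (x : ℝ) :
    ∀ᵐ y ∂πV.prod πA, 0 ≤ y.2 - y.1 * max x 0 := by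
  have h1 := (Measure.quasiMeasurePreserving_fst (μ := πV) (ν := πA)).ae hV
  have h2 := (Measure.quasiMeasurePreserving_snd (μ := πV) (ν := πA)).ae hA
  filter_upwards [h1, h2] with y hy1 hy2
  nlinarith [le_max_right x 0, mul_nonneg (neg_nonneg.2 hy1.le) (le_max_right x 0)]

theorem ae_nonneg_sub_mul_max_prod [SFinite πV] [SFinite πA]
    (hV : ∀ᵐ v ∂πV, v < 0) (hA : ∀ᵐ a ∂πA, 0 ≤ a) :
    ∀ᵐ y ∂ν.prod (πV.prod πA), 0 ≤ y.2.2 - y.2.1 * max y.1 0 := by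
  refine (Measure.ae_prod_iff_ae_ae ?_).2 (ae_of_all _ fun x => ae_nonneg_sub_mul_max hV hA x)
  exact measurableSet_le measurable_const (by fun_prop)

variable [IsProbabilityMeasure ν] [IsProbabilityMeasure πV] [IsProbabilityMeasure πA]
  [IsProbabilityMeasure πB]

/-- Fubini, with b integrated innermost: the step depends on (x, v, a) only through z = a - v max(x,
0). -/
theorem lst_map_lindleyStep (s : ℂ) (hs : 0 ≤ s.re) :
    lst ((ν.prod (πV.prod (πA.prod πB))).map lindleyStep) id s =
      ∫ z, lst πB (fun b => max (b - z) 0) s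
        ∂((ν.prod (πV.prod πA)).map fun y => y.2.2 - y.2.1 * max y.1 0) := by
  have hg : StronglyMeasurable fun z : ℝ => lst πB (fun b => max (b - z) 0) s :=
    stronglyMeasurable_lst_max_sub measurable_id s
  have hgb : ∀ z, ‖lst πB (fun b => max (b - z) 0) s‖ ≤ 1 := fun z =>
    norm_lst_le_one (ae_of_all _ fun ω => le_max_right _ _) hs
  rw [integral_map (by fun_prop) hg.aestronglyMeasurable, lst,
    integral_map measurable_lindleyStep.aemeasurable (by fun_prop), integral_prod, integral_prod]
  · refine integral_congr_ae (ae_of_all _ fun x => ?_)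
    simp only
    rw [integral_prod, integral_prod]
    · refine integral_congr_ae (ae_of_all _ fun v => ?_)
      simp only
      rw [integral_prod]
      · refine integral_congr_ae (ae_of_all _ fun a => ?_)
        simp only [lst]
        refine integral_congr_ae (ae_of_all _ fun b => ?_)
        simp only [lindleyStep, id]
        rw [show v * max x 0 + (b - a) = b - (a - v * max x 0) by ring]
      · exact integrable_exp_neg_mul (X := fun y : ℝ × ℝ => lindleyStep (x, v, y))
          (measurable_lindleyStep.comp (by fun_prop)) (ae_of_all _ fun _ => le_max_right _ _) hs
    · exact Integrable.of_bound (hg.comp_measurable (by fun_prop)).aestronglyMeasurable 1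
        (ae_of_all _ fun y => hgb _)
    · exact integrable_exp_neg_mul (X := fun y : ℝ × ℝ × ℝ => lindleyStep (x, y))
        (measurable_lindleyStep.comp (by fun_prop)) (ae_of_all _ fun _ => le_max_right _ _) hs
  · exact Integrable.of_bound (hg.comp_measurable (by fun_prop)).aestronglyMeasurable 1
      (ae_of_all _ fun y => hgb _)
  · exact integrable_exp_neg_mul measurable_lindleyStep (ae_of_all _ fun _ => le_max_right _ _) hs

/-- The exponential splits as e^{qa} e^{-qvx}. Both factors are bounded, as Re q < 0, a ≥ 0, v < 0
and x ≥ 0, and integrating over x first yields the transform of ν at q v. -/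
theorem integral_exp_map_sub_mul_max (hν : ∀ᵐ x ∂ν, 0 ≤ x) (hV : ∀ᵐ v ∂πV, v < 0)
    (hA : ∀ᵐ a ∂πA, 0 ≤ a) {q : ℂ} (hq : q.re < 0) :
    ∫ z : ℝ, Complex.exp (q * z) ∂((ν.prod (πV.prod πA)).map fun y => y.2.2 - y.2.1 * max y.1 0) =
      lst πA id (-q) * ∫ v in Set.Iio (0 : ℝ), lst ν id (q * v) ∂πV := by
  have hq' : 0 ≤ (-q).re := by simpa using hq.le
  rw [integral_map (by fun_prop) (by fun_prop), integral_prod]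
  · have h1 : ∀ x : ℝ, ∫ y : ℝ × ℝ, Complex.exp (q * ((y.2 - y.1 * max x 0 : ℝ) : ℂ)) ∂πV.prod πA =
        lst πA id (-q) * ∫ v : ℝ, Complex.exp (-(q * v) * ((max x 0 : ℝ) : ℂ)) ∂πV := by
      intro x
      rw [mul_comm, lst, ← integral_prod_mul (μ := πV) (ν := πA)
        (fun v : ℝ => Complex.exp (-(q * v) * ((max x 0 : ℝ) : ℂ)))]
      refine integral_congr_ae (ae_of_all _ fun y => ?_)
      simp only [id]
      rw [← Complex.exp_add]
      congr 1
      push_cast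
      ring
    simp only [h1]
    rw [integral_const_mul, integral_integral_swap,
      Measure.restrict_eq_self_of_ae_mem (s := Set.Iio (0 : ℝ)) hV]
    · congr 1
      refine integral_congr_ae (ae_of_all _ fun v => ?_)
      refine integral_congr_ae (hν.mono fun x hx => ?_)
      simp only [id, max_eq_left hx]
    · refine (integrable_exp_neg_mul (P := ν.prod πV) (X := fun y : ℝ × ℝ => -y.2 * max y.1 0)
        (by fun_prop) ?_ hq').congr (ae_of_all _ fun y => ?_)
      · filter_upwards [(Measure.quasiMeasurePreserving_snd (μ := ν) (ν := πV)).ae hV] with y hy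
        exact mul_nonneg (neg_nonneg.2 hy.le) (le_max_right _ _)
      · simp only [Function.uncurry]
        congr 1
        push_cast
        ring
  · simpa using integrable_exp_neg_mul (P := ν.prod (πV.prod πA))
      (X := fun y : ℝ × ℝ × ℝ => y.2.2 - y.2.1 * max y.1 0) (by fun_prop)
      (ae_nonneg_sub_mul_max_prod hV hA) hq'

/-- After one step of the recursion the transform is a polynomial over `poleProd p`, and the values
of this polynomial at the poles are determined by the previous transform. -/
theorem exists_polynomial_lst_step (hν : ∀ᵐ x ∂ν, 0 ≤ x) (hV : ∀ᵐ v ∂πV, v < 0)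
    (hA : ∀ᵐ a ∂πA, 0 ≤ a) (hB : ∀ᵐ b ∂πB, 0 ≤ b) {l : ℕ} {p : Fin l → ℂ} {N : Polynomial ℂ}
    (hp : ∀ j, (p j).re < 0) (hrat : HasRationalLST πB id p N) :
    ∃ Q : Polynomial ℂ, Q.degree < ((l + 1 : ℕ) : WithBot ℕ) ∧
      (∀ s : ℂ, 0 ≤ s.re → Q.eval s =
        poleProd p s * lst ((ν.prod (πV.prod (πA.prod πB))).map lindleyStep) id s) ∧
      ∀ j, Q.eval (p j) = N.eval (p j) *
        (lst πA id (-p j) * ∫ v in Set.Iio (0 : ℝ), lst ν id (p j * v) ∂πV) := by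
  have hm : Measurable fun y : ℝ × ℝ × ℝ => y.2.2 - y.2.1 * max y.1 0 := by fun_prop
  have : IsProbabilityMeasure
      ((ν.prod (πV.prod πA)).map fun y => y.2.2 - y.2.1 * max y.1 0) :=
    Measure.isProbabilityMeasure_map hm.aemeasurable
  obtain ⟨Q, hQd, hQs, hQp⟩ := exists_polynomial_integral_lst_max_sub measurable_id hB hp hrat
    ((ν.prod (πV.prod πA)).map fun y => y.2.2 - y.2.1 * max y.1 0)
    ((ae_map_iff hm.aemeasurable measurableSet_Ici).2 (ae_nonneg_sub_mul_max_prod hV hA))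
  refine ⟨Q, hQd, fun s hs => ?_, fun j => ?_⟩
  · rw [hQs s hs, lst_map_lindleyStep s hs]
    rfl
  · rw [hQp j, integral_exp_map_sub_mul_max hν hV hA (hp j)]

end StepTransform

/-! ### The linear system -/

/-- Makes the integrals in the linear system absolutely convergent, so that sum and integral may be
exchanged. -/
theorem exists_norm_pow_div_poleProd_le {l : ℕ} {p : Fin l → ℂ} (hp : ∀ j, (p j).re < 0) {q : ℂ}
    (hq : q.re < 0) {k : ℕ} (hk : k ≤ l) :
    ∃ C : ℝ, ∀ y : ℝ, y < 0 → ‖(y : ℂ) ^ k / poleProd p (q * y)‖ ≤ C := by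
  -- For y < 0, Re(q y - p m) = (-Re q)(-y) + (-Re (p m)) ≥ c m (1 - y).
  set c : Fin l → ℝ := fun m => min (-q.re) (-(p m).re) with hc
  have hcpos : ∀ m, 0 < c m := fun m => lt_min (by linarith) (by linarith [hp m])
  refine ⟨(∏ m, c m)⁻¹, fun y hy => ?_⟩
  have hprod : (∏ m, c m) * (1 - y) ^ l ≤ ‖poleProd p (q * y)‖ := by
    have h1 : (∏ m, c m) * (1 - y) ^ l = ∏ m, c m * (1 - y) := by
      rw [Finset.prod_mul_distrib]; simp
    rw [h1, poleProd, norm_prod]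
    refine Finset.prod_le_prod (fun m _ => mul_nonneg (hcpos m).le (by linarith)) fun m _ => ?_
    refine le_trans ?_ (Complex.re_le_norm _)
    simp only [Complex.sub_re, Complex.mul_re, Complex.ofReal_re, Complex.ofReal_im, mul_zero,
      sub_zero]
    have h2 : c m ≤ -q.re := min_le_left _ _
    have h3 : c m ≤ -(p m).re := min_le_right _ _
    nlinarith
  have hpos : 0 < ∏ m, c m := Finset.prod_pos fun m _ => hcpos m
  have hy1 : (0 : ℝ) < (1 - y) ^ l := pow_pos (by linarith) _
  rw [norm_div, norm_pow, Complex.norm_real, Real.norm_eq_abs, abs_of_neg hy,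
    div_le_iff₀ ((mul_pos hpos hy1).trans_le hprod)]
  calc (-y) ^ k ≤ (1 - y) ^ k := pow_le_pow_left₀ (by linarith) (by linarith) _
    _ ≤ (1 - y) ^ l := pow_le_pow_right₀ (by linarith) hk
    _ = (∏ m, c m)⁻¹ * ((∏ m, c m) * (1 - y) ^ l) := by field_simp
    _ ≤ _ := by gcongr

theorem Polynomial.eval_eq_sum_fin_of_degree_lt {n : ℕ} {Q : Polynomial ℂ}
    (hQ : Q.degree < ((n + 1 : ℕ) : WithBot ℕ)) (t : ℂ) :
    Q.eval t = ∑ k : Fin (n + 1), Q.coeff k * t ^ (k : ℕ) := by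
  have hQ' : Q.natDegree < n + 1 := by
    rcases eq_or_ne Q 0 with rfl | h
    · simp
    · exact (Polynomial.natDegree_lt_iff_degree_lt h).2 hQ
  rw [Polynomial.eval_eq_sum_range' hQ',
    Fin.sum_univ_eq_sum_range (fun k => Q.coeff k * t ^ k)]

/-- If the numerator `Q` of a rational transform satisfies the fixed-point relation at the pole
`p j`, then its coefficients solve the corresponding linear equation. -/
theorem sum_coeff_mul_one_sub_eq_zero {ν π : Measure ℝ} [IsProbabilityMeasure π]
    {l : ℕ} {p : Fin l → ℂ} (hp : ∀ j, (p j).re < 0) {Q : Polynomial ℂ}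
    (hQ : Q.degree < ((l + 1 : ℕ) : WithBot ℕ))
    (hν : ∀ s : ℂ, 0 ≤ s.re → lst ν id s = Q.eval s / poleProd p s) {c : ℂ} {j : Fin l}
    (hj : Q.eval (p j) = c * ∫ v in Set.Iio (0 : ℝ), lst ν id (p j * v) ∂π) :
    ∑ k : Fin (l + 1), Q.coeff k * p j ^ (k : ℕ) *
      (1 - c * ∫ y in Set.Iio (0 : ℝ),
        (y : ℂ) ^ (k : ℕ) / ∏ m, (p j * (y : ℂ) - p m) ∂π) = 0 := by
  have h1 : ∫ v in Set.Iio (0 : ℝ), lst ν id (p j * v) ∂π =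
      ∑ k : Fin (l + 1), Q.coeff k * p j ^ (k : ℕ) * ∫ y in Set.Iio (0 : ℝ),
        (y : ℂ) ^ (k : ℕ) / ∏ m, (p j * (y : ℂ) - p m) ∂π := by
    simp only [← integral_const_mul]
    rw [← integral_finsetSum]
    · refine setIntegral_congr_fun measurableSet_Iio fun y hy => ?_
      have hre : 0 ≤ (p j * (y : ℂ)).re := by
        have hy : y < 0 := hy
        simp only [Complex.mul_re, Complex.ofReal_re, Complex.ofReal_im, mul_zero, sub_zero]
        exact (mul_pos_of_neg_of_neg (hp j) hy).le
      rw [hν _ hre, Polynomial.eval_eq_sum_fin_of_degree_lt hQ, Finset.sum_div]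
      refine Finset.sum_congr rfl fun k _ => ?_
      rw [mul_pow, poleProd]
      ring
    · intro k _
      obtain ⟨C, hC⟩ := exists_norm_pow_div_poleProd_le hp (hp j) (Nat.lt_succ_iff.1 k.2)
      refine Integrable.const_mul (Integrable.of_bound ?_ C ?_) _
      · refine Measurable.aestronglyMeasurable (Measurable.div (by fun_prop) ?_)
        exact Finset.measurable_prod _ fun m _ => by fun_prop
      · filter_upwards [ae_restrict_mem measurableSet_Iio] with y hy using hC y hy
  have h2 := hj
  rw [h1, Polynomial.eval_eq_sum_fin_of_degree_lt hQ, Finset.mul_sum] at h2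
  rw [← sub_eq_zero, ← Finset.sum_sub_distrib] at h2
  rw [← h2]
  refine Finset.sum_congr rfl fun k _ => ?_
  ring

/-! ### Abel means -/

theorem summable_pow_mul_of_tendsto {c : ℕ → ℂ} {a : ℂ} (hc : Tendsto c atTop (𝓝 a)) {r : ℝ}
    (hr : r ∈ Set.Ioo (0 : ℝ) 1) : Summable fun n => (r : ℂ) ^ n * c n := by
  obtain ⟨C, hC⟩ := (Metric.isBounded_range_of_tendsto c hc).exists_norm_le
  refine Summable.of_norm_bounded (g := fun n => r ^ n * C)
    ((summable_geometric_of_lt_one hr.1.le hr.2).mul_right C) fun n => ?_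
  rw [norm_mul, norm_pow, Complex.norm_real, Real.norm_of_nonneg hr.1.le]
  exact mul_le_mul_of_nonneg_left (hC _ ⟨n, rfl⟩) (pow_nonneg hr.1.le _)

/-- Abel means of a convergent sequence converge to its limit. -/
theorem tendsto_one_sub_mul_tsum_pow_mul {c : ℕ → ℂ} {a : ℂ} (hc : Tendsto c atTop (𝓝 a)) :
    Tendsto (fun r : ℝ => (1 - (r : ℂ)) * ∑' n, (r : ℂ) ^ n * c n) (𝓝[<] 1) (𝓝 a) := by
  -- The increments of c, with f 0 = c 0: their power series is (1 - r) ∑ r^n c n, so Abel's limit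
  -- theorem applies.
  set f : ℕ → ℂ := fun n => Nat.casesOn n (c 0) fun m => c (m + 1) - c m with hf
  have hsum : ∀ n, ∑ i ∈ Finset.range (n + 1), f i = c n := by
    intro n
    rw [Finset.sum_range_succ', add_comm, Finset.sum_range_sub]
    simp [hf]
  have hlim : Tendsto (fun n => ∑ i ∈ Finset.range n, f i) atTop (𝓝 a) :=
    (tendsto_add_atTop_iff_nat 1).1 (hc.congr fun n => (hsum n).symm)
  have habel := Complex.tendsto_tsum_powerSeries_nhdsWithin_lt hlim
  rw [tendsto_map'_iff] at habel
  refine habel.congr' ?_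
  filter_upwards [Ioo_mem_nhdsLT (zero_lt_one (α := ℝ))] with r hr
  have hs := summable_pow_mul_of_tendsto hc hr
  have hs1 := (summable_nat_add_iff 1).2 hs
  have hshift : ∀ n, f (n + 1) * (r : ℂ) ^ (n + 1) =
      (r : ℂ) ^ (n + 1) * c (n + 1) - r * ((r : ℂ) ^ n * c n) := fun n => by
    simp only [hf]; ring
  have hsf : Summable fun n => f n * (r : ℂ) ^ n := by
    rw [← summable_nat_add_iff 1]
    exact (hs1.sub (hs.mul_left (r : ℂ))).congr fun n => (hshift n).symm
  simp only [Function.comp_apply]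
  rw [hsf.tsum_eq_zero_add, tsum_congr hshift, hs1.tsum_sub (hs.mul_left _), tsum_mul_left, sub_mul,
    one_mul]
  conv_rhs => rw [hs.tsum_eq_zero_add]
  conv_lhs => rw [hs.tsum_eq_zero_add]
  rw [show f 0 = c 0 from rfl]
  ring

/-! ### Assembly -/

theorem theorem5 {Ω : Type*} [MeasurableSpace Ω] (P : Measure Ω) [IsProbabilityMeasure P]
    (V A B : ℕ → Ω → ℝ)
    (hVm : ∀ i, Measurable (V i)) (hAm : ∀ i, Measurable (A i)) (hBm : ∀ i, Measurable (B i))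
    -- all the variables `V_i, A_i, B_i` are independent, and each sequence is identically
    -- distributed
    (hindep : iIndepFun (Sum.elim V (Sum.elim A B)) P)
    (hVid : ∀ i, IdentDistrib (V i) (V 0) P P)
    (hAid : ∀ i, IdentDistrib (A i) (A 0) P P)
    (hBid : ∀ i, IdentDistrib (B i) (B 0) P P)
    (hA : ∀ i, ∀ᵐ ω ∂P, 0 ≤ A i ω) (hB : ∀ i, ∀ᵐ ω ∂P, 0 ≤ B i ω)
    -- condition (A)
    (hV : ∀ i, ∀ᵐ ω ∂P, V i ω < 0)
    -- condition (B)
    (l : ℕ) (p : Fin l → ℂ) (N : Polynomial ℂ)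
    (hp : ∀ j, (p j).re < 0) (hBrat : HasRationalLST P (B 0) p N)
    (hBA : 0 < P {ω | B 0 ω ≤ A 0 ω}) :
    ∃ (μ : ProbabilityMeasure ℝ) (a : Fin (l + 1) → ℂ),
      (∀ᵐ x ∂(μ : Measure ℝ), 0 ≤ x) ∧
      -- weak convergence to a proper limit, from every initial state
      (∀ w : ℝ, 0 ≤ w →
        TendstoInDistribution (lindleyProcess w V (fun i ω => B i ω - A i ω)) atTop
          (id : ℝ → ℝ) (fun _ => P) (μ : Measure ℝ)) ∧
      -- the transform of the limit
      (∀ s : ℂ, 0 ≤ s.re →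
        lst (μ : Measure ℝ) id s = (∑ k, a k * s ^ (k : ℕ)) / poleProd p s) ∧
      a 0 = (-1) ^ l * ∏ i, p i ∧
      -- the linear system for the coefficients
      (∀ j, ∑ k, a k * p j ^ (k : ℕ) *
        (1 - N.eval (p j) * lst P (A 0) (-p j) *
          ∫ y in Set.Iio (0 : ℝ),
            (y : ℂ) ^ (k : ℕ) / ∏ m, (p j * (y : ℂ) - p m) ∂(P.map (V 0))) = 0) ∧
      -- the coefficients are the limits of `(1 - r) a_k(r)`, where the `a_k(r)` are the
      -- coefficients in the transient transform
      (∀ w : ℝ, 0 ≤ w → ∃ α : ℝ → Fin (l + 1) → ℂ,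
        (∀ r ∈ Set.Ioo (0 : ℝ) 1, ∀ s : ℂ, 0 ≤ s.re →
          lstGen P (lindleyProcess w V (fun i ω => B i ω - A i ω)) r s =
            Complex.exp (-s * (w : ℂ)) + (∑ k, α r k * s ^ (k : ℕ)) / poleProd p s) ∧
        ∀ k, Tendsto (fun r : ℝ => (1 - (r : ℂ)) * α r k) (𝓝[<] 1) (𝓝 (a k))) := by
  have hlst : ∀ {X : Ω → ℝ}, Measurable X → ∀ s, lst (P.map X) id s = lst P X s := by
    intro X hX s
    rw [lst, integral_map hX.aemeasurable (by fun_prop)]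
    rfl
  have hVp := Measure.isProbabilityMeasure_map (μ := P) (hVm 0).aemeasurable
  have hAp := Measure.isProbabilityMeasure_map (μ := P) (hAm 0).aemeasurable
  have hBp := Measure.isProbabilityMeasure_map (μ := P) (hBm 0).aemeasurable
  have hV0 : ∀ᵐ v ∂P.map (V 0), v < 0 :=
    (ae_map_iff (hVm 0).aemeasurable measurableSet_Iio).2 (hV 0)
  have hA0 : ∀ᵐ a ∂P.map (A 0), 0 ≤ a :=
    (ae_map_iff (hAm 0).aemeasurable measurableSet_Ici).2 (hA 0)
  have hB0 : ∀ᵐ b ∂P.map (B 0), 0 ≤ b :=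
    (ae_map_iff (hBm 0).aemeasurable measurableSet_Ici).2 (hB 0)
  have hrat : HasRationalLST (P.map (B 0)) id p N :=
    ⟨hBrat.degree_lt, hBrat.eval_ne_zero, fun s hs => (hlst (hBm 0) s).trans (hBrat.lst_eq s hs)⟩
  have hS : MeasurableSet {t : ℝ × ℝ × ℝ | t.1 ≤ 0 ∧ t.2.2 ≤ t.2.1} :=
    MeasurableSet.inter (s₁ := {t : ℝ × ℝ × ℝ | t.1 ≤ 0}) (s₂ := {t : ℝ × ℝ × ℝ | t.2.2 ≤ t.2.1})
      (measurableSet_le (by fun_prop) (by fun_prop)) (measurableSet_le (by fun_prop) (by fun_prop))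
  have hπS : ((P.map (V 0)).prod ((P.map (A 0)).prod (P.map (B 0))))
      {t : ℝ × ℝ × ℝ | t.1 ≤ 0 ∧ t.2.2 ≤ t.2.1} ≠ 0 := by
    rw [← map_innovation_eq_prod hVm hAm hBm hindep hVid hAid hBid 0,
      Measure.map_apply ((hVm 0).prodMk ((hAm 0).prodMk (hBm 0))) hS]
    refine (hBA.trans_le (measure_mono_ae ?_)).ne'
    filter_upwards [hV 0] with ω h1 h2 using ⟨h1.le, h2⟩
  obtain ⟨μ, hμ, hinv, hconv⟩ := exists_invariant_of_reset measurable_lindleyStep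
    ((P.map (V 0)).prod ((P.map (A 0)).prod (P.map (B 0)))) hS hπS (e := 0)
    (by
      rintro x t ⟨h1, h2⟩
      refine max_eq_right ?_
      have := mul_nonpos_of_nonpos_of_nonneg h1 (le_max_right x 0)
      simp only
      linarith)
  obtain ⟨μ, rfl⟩ : ∃ μ' : ProbabilityMeasure ℝ, (μ' : Measure ℝ) = μ := ⟨⟨μ, hμ⟩, rfl⟩
  have hμ0 : ∀ᵐ x ∂(μ : Measure ℝ), 0 ≤ x := by
    rw [← hinv]
    exact (ae_map_iff measurable_lindleyStep.aemeasurable measurableSet_Ici).2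
      (ae_of_all _ fun _ => le_max_right _ _)
  have hWm := measurable_lindleyProcess hVm hAm hBm
  have hWp : ∀ w n, IsProbabilityMeasure
      (P.map (lindleyProcess w V (fun i ω => B i ω - A i ω) n)) := fun w n =>
    Measure.isProbabilityMeasure_map (hWm w n).aemeasurable
  have hWconv : ∀ w : ℝ, 0 ≤ w → ∀ {F : Type} [NormedAddCommGroup F] [NormedSpace ℝ F]
      (f : ℝ → F) (C : ℝ), StronglyMeasurable f → (∀ x, ‖f x‖ ≤ C) →
      Tendsto (fun n => ∫ x, f x ∂P.map (lindleyProcess w V (fun i ω => B i ω - A i ω) n)) atTop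
        (𝓝 (∫ x, f x ∂(μ : Measure ℝ))) := fun w hw F _ _ f C hf hC =>
    hconv (fun n => P.map (lindleyProcess w V (fun i ω => B i ω - A i ω) n)) (hWp w 0)
      (map_lindleyProcess_succ hVm hAm hBm hindep hVid hAid hBid hw) f C hf hC
  have hlstconv : ∀ w : ℝ, 0 ≤ w → ∀ s : ℂ, 0 ≤ s.re →
      Tendsto (fun n => lst P (lindleyProcess w V (fun i ω => B i ω - A i ω) n) s) atTop
        (𝓝 (lst (μ : Measure ℝ) id s)) := by
    intro w hw s hs
    -- Truncating x at 0 makes the test function bounded on the whole line without changing it on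
    -- the support of the laws.
    have h := hWconv w hw (fun x : ℝ => Complex.exp (-s * ((max x 0 : ℝ) : ℂ))) 1
      (Measurable.stronglyMeasurable (by fun_prop))
      (fun x => norm_exp_neg_mul_ofReal_le_one hs (le_max_right _ _))
    have hlim : ∫ x : ℝ, Complex.exp (-s * ((max x 0 : ℝ) : ℂ)) ∂(μ : Measure ℝ) = lst (μ : Measure ℝ) id s :=
      integral_congr_ae (hμ0.mono fun x hx => by simp only [max_eq_left hx, id])
    rw [hlim] at h
    refine h.congr fun n => ?_
    rw [integral_map (hWm w n).aemeasurable (Measurable.aestronglyMeasurable (by fun_prop))]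
    refine integral_congr_ae (ae_of_all _ fun ω => ?_)
    simp only
    rw [max_eq_left (lindleyProcess_nonneg hw _ _ n ω)]
  obtain ⟨Q, hQd, hQs, hQp⟩ := exists_polynomial_lst_step hμ0 hV0 hA0 hB0 hp hrat
  -- By invariance `Q` now represents the transform of μ itself, while `hQp` expresses its values at
  -- the poles through that same transform.
  rw [hinv] at hQs
  have hμQ : ∀ s : ℂ, 0 ≤ s.re → lst (μ : Measure ℝ) id s = Q.eval s / poleProd p s := fun s hs => by
    rw [hQs s hs, mul_div_cancel_left₀ _ (poleProd_ne_zero hp hs)]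
  refine ⟨μ, fun k => Q.coeff k, hμ0, fun w hw => ⟨fun n => (hWm w n).aemeasurable,
    aemeasurable_id, ?_⟩, fun s hs => ?_, ?_, fun j => ?_, fun w hw => ?_⟩
  · refine ProbabilityMeasure.tendsto_iff_forall_integral_tendsto.2 fun f => ?_
    simpa using hWconv w hw f ‖f‖ f.continuous.stronglyMeasurable f.norm_coe_le_norm
  · rw [← Polynomial.eval_eq_sum_fin_of_degree_lt hQd]
    exact hμQ s hs
  · have h0 := hQs 0 le_rfl
    have h1 : lst (μ : Measure ℝ) id 0 = 1 := by simp [lst]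
    rw [h1, mul_one, ← Polynomial.coeff_zero_eq_eval_zero] at h0
    simp only [Fin.val_zero, h0, poleProd, zero_sub]
    rw [Finset.prod_neg]
    simp
  · refine sum_coeff_mul_one_sub_eq_zero hp hQd hμQ ?_
    rw [hQp j, hlst (hAm 0), mul_assoc]
  · have hex := fun n => exists_polynomial_lst_step
      (ν := P.map (lindleyProcess w V (fun i ω => B i ω - A i ω) n))
      ((ae_map_iff (hWm w n).aemeasurable measurableSet_Ici).2
        (ae_of_all _ (lindleyProcess_nonneg hw _ _ n))) hV0 hA0 hB0 hp hrat
    choose q hqd hqs _ using hex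
    have hqs' : ∀ n, ∀ s : ℂ, 0 ≤ s.re → (q n).eval s =
        poleProd p s * lst P (lindleyProcess w V (fun i ω => B i ω - A i ω) (n + 1)) s := by
      intro n s hs
      rw [hqs n s hs, ← map_lindleyProcess_succ hVm hAm hBm hindep hVid hAid hBid hw,
        hlst (hWm w (n + 1))]
    have hcoeff : ∀ k, Tendsto (fun n => (q n).coeff k) atTop (𝓝 (Q.coeff k)) := by
      intro k
      simp only [Polynomial.coeff_eq_sum_basis_of_degree_lt (hqd _) k]
      rw [Polynomial.coeff_eq_sum_basis_of_degree_lt hQd k]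
      refine tendsto_finsetSum _ fun i _ => Tendsto.mul_const _ ?_
      rw [hQs i (by simp)]
      simp only [hqs' _ (i : ℂ) (by simp)]
      exact ((tendsto_add_atTop_iff_nat 1).2 (hlstconv w hw i (by simp))).const_mul _
    have hsum : ∀ r ∈ Set.Ioo (0 : ℝ) 1, ∀ k, Summable fun n => (r : ℂ) ^ n * (q n).coeff k :=
      fun r hr k => summable_pow_mul_of_tendsto (hcoeff k) hr
    -- The term i = 0 is e^{-sw}; since q n belongs to W_{n+1}, the shift leaves the factor r, which
    -- tends to 1.
    refine ⟨fun r k => r * ∑' n, (r : ℂ) ^ n * (q n).coeff k, fun r hr s hs => ?_, fun k => ?_⟩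
    · have hs0 : Summable fun n => (r : ℂ) ^ n *
          lst P (lindleyProcess w V (fun i ω => B i ω - A i ω) n) s :=
        summable_pow_mul_of_tendsto (hlstconv w hw s hs) hr
      rw [lstGen, hs0.tsum_eq_zero_add]
      congr 1
      · simp [lst, lindleyProcess]
      · have hterm : ∀ n, (r : ℂ) ^ (n + 1) *
            lst P (lindleyProcess w V (fun i ω => B i ω - A i ω) (n + 1)) s =
            ∑ k : Fin (l + 1), (r : ℂ) ^ n * (q n).coeff k * (r * s ^ (k : ℕ) / poleProd p s) := by
          intro n
          rw [eq_div_of_mul_eq (poleProd_ne_zero hp hs)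
            ((mul_comm _ _).trans (hqs' n s hs).symm),
            Polynomial.eval_eq_sum_fin_of_degree_lt (hqd n), Finset.sum_div, Finset.mul_sum]
          refine Finset.sum_congr rfl fun k _ => ?_
          ring
        rw [tsum_congr hterm, Summable.tsum_finsetSum fun (k : Fin (l + 1)) _ =>
          (hsum r hr k).mul_right (r * s ^ (k : ℕ) / poleProd p s), Finset.sum_div]
        refine Finset.sum_congr rfl fun k _ => ?_
        rw [tsum_mul_right]
        ring
    · have hr : Tendsto (fun r : ℝ => (r : ℂ)) (𝓝[<] 1) (𝓝 1) :=
        (Complex.continuous_ofReal.tendsto' 1 1 Complex.ofReal_one).mono_left nhdsWithin_le_nhds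
      have h := hr.mul (tendsto_one_sub_mul_tsum_pow_mul (hcoeff k))
      rw [one_mul] at h
      refine h.congr fun r => ?_
      ring
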